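/- For every countable ordinal $\alpha>0$ let $\pi_\alpha:\omega\to\alpha$ be a function such that $\pi_{\beta+1}$ is constantly $\beta$ and, for limit $\lambda$, $\pi_\lambda$ is nondecreasing and cofinal in $\lambda$. Define topological spaces $X^\alpha$ by $X^0=2=\{0,1\}$ (discrete) and $X^\alpha=\prod_{n\in\omega}X^{\pi_\alpha(n)}$ (product topology) for $\alpha>0$. The $\alpha$-th iterates $F^\alpha,I^\alpha\subseteq X^\alpha$ of the Fréchet filter and the Fréchet ideal are defined by $F^0=\{1\}$, $I^0=\{0\}$ and, for $\alpha>0$, $$F^\alpha=\{x\in X^\alpha:\exists n\,\forall m>n\;\,x(m)\in F^{\pi_\alpha(m)}\},\qquad I^\alpha=\{x\in X^\alpha:\exists n\,\forall m>n\;\,x(m)\in I^{\pi_\alpha(m)}\}.$$ **Theorem (Debs–Saint Raymond).** Let $\alpha<\omega_1$. 1. If $\alpha\ge 1$, then $F^\alpha$ and $I^\alpha$ cannot be separated by disjoint $\mathbf{\Pi}^0_{\alpha+1}$ sets: there are no disjoint $\mathbf{\Pi}^0_{\alpha+1}$ sets $A,B\subseteq X^\alpha$ with $F^\alpha\subseteq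 A$ and $I^\alpha\subseteq B$. 2. There are disjoint $\mathbf{\Sigma}^0_{\alpha+1}$ sets $A,B\subseteq X^\alpha$ with $F^\alpha\subseteq A$ and $I^\alpha\subseteq B$. -/

import Mathlib

open Ordinal Order Set

/-- A choice, for every nonzero countable ordinal `α`, of a sequence `π_α : ω → α`:
the constant sequence `β` if `α = β + 1`, and a nondecreasing cofinal sequence of ordinals below `α`
if `α` is a limit. (The values of `seq` at `0` and at uncountable ordinals are irrelevant.) -/
structure FundamentalSystem where
  /-- `seq α n` is `π_α(n)`. -/
  seq : Ordinal.{0} → ℕ → Ordinal.{0}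
  seq_succ : ∀ β : Ordinal.{0}, β + 1 < ω_ 1 → ∀ n, seq (β + 1) n = β
  seq_lt : ∀ l : Ordinal.{0}, IsSuccLimit l → l < ω_ 1 → ∀ n, seq l n < l
  seq_mono : ∀ l : Ordinal.{0}, IsSuccLimit l → l < ω_ 1 → Monotone (seq l)
  seq_cofinal : ∀ l : Ordinal.{0}, IsSuccLimit l → l < ω_ 1 → ∀ β < l, ∃ n, β ≤ seq l n

/-- Well-founded trees all of whose non-leaf nodes have exactly `ω` many immediate successors. -/
inductive OmegaTree : Type
  | leaf : OmegaTree
  | node : (ℕ → OmegaTree) → OmegaTree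

namespace OmegaTree

/-- The space attached to a tree: `2` for a leaf, and the product of the spaces attached to the
immediate subtrees otherwise. -/
def Space : OmegaTree → Type
  | leaf => Bool
  | node t => ∀ n, (t n).Space

/-- The discrete topology on `2`, and iterated product topologies. -/
instance instTopologicalSpaceSpace : ∀ t : OmegaTree, TopologicalSpace t.Space
  | leaf => inferInstanceAs (TopologicalSpace Bool)
  | node t => @Pi.topologicalSpace ℕ (fun n => (t n).Space)
      (fun n => instTopologicalSpaceSpace (t n))

/-- Given `b ∈ {0, 1}`: the set `{b}` at a leaf; at a node, the points `x` such that for all but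
finitely many `m` the coordinate `x m` belongs to the corresponding set for the `m`-th subtree. -/
def eventualSet (b : Bool) : ∀ t : OmegaTree, Set t.Space
  | leaf => ({b} : Set Bool)
  | node t => {x : ∀ n, (t n).Space | ∃ n, ∀ m > n, x m ∈ eventualSet b (t m)}

end OmegaTree

namespace FundamentalSystem

open Classical in
/-- The tree `T_α`: `T_0` is a single leaf, and for `α > 0` the `n`-th immediate subtree of `T_α`
is `T_{π_α(n)}`. (See `tree_zero` and `tree_of_pos`.) -/
noncomputable def tree (π : FundamentalSystem) (α : Ordinal.{0}) : OmegaTree :=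
  if α = 0 then .leaf
  else .node fun n => if _h : π.seq α n < α then tree π (π.seq α n) else .leaf
termination_by α

theorem seq_lt_self (π : FundamentalSystem) {α : Ordinal.{0}} (h0 : 0 < α) (h1 : α < ω_ 1)
    (n : ℕ) : π.seq α n < α := by
  rcases zero_or_succ_or_isSuccLimit α with rfl | ⟨β, rfl⟩ | h
  · exact absurd h0 (lt_irrefl _)
  · rw [Order.succ_eq_add_one] at h1 ⊢
    rw [π.seq_succ β h1 n]
    exact lt_add_one β
  · exact π.seq_lt α h h1 n

theorem tree_zero (π : FundamentalSystem) : π.tree 0 = .leaf := by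
  rw [tree, if_pos rfl]

theorem tree_of_pos (π : FundamentalSystem) {α : Ordinal.{0}} (h0 : 0 < α) (h1 : α < ω_ 1) :
    π.tree α = .node fun n => π.tree (π.seq α n) := by
  rw [tree, if_neg h0.ne']
  congr 1
  funext n
  rw [dif_pos (π.seq_lt_self h0 h1 n)]

/-- The space `X^α`: `X^0 = 2` and `X^α = ∏ n, X^{π_α(n)}` for `α > 0`. -/
abbrev Space (π : FundamentalSystem) (α : Ordinal.{0}) : Type := (π.tree α).Space

/-- The `α`-th iterate `F^α ⊆ X^α` of the Fréchet filter: `F^0 = {1}`, and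
`F^α = {x | ∃ n, ∀ m > n, x(m) ∈ F^{π_α(m)}}` for `α > 0`. -/
def frechetFilter (π : FundamentalSystem) (α : Ordinal.{0}) : Set (π.Space α) :=
  (π.tree α).eventualSet true

/-- The `α`-th iterate `I^α ⊆ X^α` of the Fréchet ideal: `I^0 = {0}`, and
`I^α = {x | ∃ n, ∀ m > n, x(m) ∈ I^{π_α(m)}}` for `α > 0`. -/
def frechetIdeal (π : FundamentalSystem) (α : Ordinal.{0}) : Set (π.Space α) :=
  (π.tree α).eventualSet false

end FundamentalSystem

/-- `IsBoldSigma α s`: the set `s` belongs to the additive Borel class `Σ⁰_α`. The class `Σ⁰_1`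
consists of the open sets; for `α > 1`, `Σ⁰_α` consists of the unions of sequences of sets
`A n` with `A n ∈ Π⁰_{β n}` (that is, `(A n)ᶜ ∈ Σ⁰_{β n}`) for some `1 ≤ β n < α`. -/
inductive IsBoldSigma {X : Type*} [TopologicalSpace X] : Ordinal.{0} → Set X → Prop
  | of_isOpen {s : Set X} (hs : IsOpen s) : IsBoldSigma 1 s
  | iUnion {α : Ordinal.{0}} (hα : 1 < α) (β : ℕ → Ordinal.{0}) (A : ℕ → Set X)
      (h1 : ∀ n, 1 ≤ β n) (hlt : ∀ n, β n < α) (hA : ∀ n, IsBoldSigma (β n) (A n)ᶜ) :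
      IsBoldSigma α (⋃ n, A n)

/-- `IsBoldPi α s`: the set `s` belongs to the multiplicative Borel class `Π⁰_α`, i.e. its
complement belongs to `Σ⁰_α`. -/
def IsBoldPi {X : Type*} [TopologicalSpace X] (α : Ordinal.{0}) (s : Set X) : Prop :=
  IsBoldSigma α sᶜ

/-!
Both halves rest on the *reduction property* of `Σ⁰_ξ` (`IsBoldSigma.reduction`): two `Σ⁰_ξ` sets
can be shrunk to disjoint `Σ⁰_ξ` sets with the same union, because in a compact, zero-dimensional,
second countable space a `Σ⁰_ξ` set is a countable union of `Δ⁰_ξ` sets.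

*Separation by `Σ⁰_{α+1}` sets* is proved by induction on `α`. If `A m`, `B m` are disjoint
`Σ⁰_{π_α(m)+1}` sets separating the `m`-th coordinate sets, then "eventually `x m ∉ B m`" and
"eventually `x m ∉ A m`" are `Σ⁰_{α+1}` conditions; the former contains `F^α` and misses `I^α`, the
latter contains `I^α` and misses `F^α`. Reducing this pair of sets makes them disjoint.

*Non-separation by `Π⁰_{α+1}` sets* is a completeness argument. Every pair of disjoint `Σ⁰_{α+1}`
subsets of Cantor space is mapped into `(F^α, I^α)` by a continuous function
(`exists_continuous_of_disjoint`): such a pair is the limit of `Δ⁰_{π_α(m)+1}` approximations `D m`,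
in the sense that every point of the first set is eventually in `D m` and every point of the second
is eventually outside, and `D m` together with its complement is mapped to the `m`-th coordinate sets
by induction. So if `F^α` and `I^α` were separated by disjoint `Π⁰_{α+1}` sets, every disjoint pair
of `Σ⁰_{α+1}` subsets of Cantor space would be too. A diagonal argument with a universal `Σ⁰_{α+1}`
set and the reduction property refutes this (`exists_disjoint_not_separated`).
-/

open TopologicalSpace Filter

/-! ### The Borel hierarchy in compact zero-dimensional second countable spaces -/

section Hierarchy

/-- `IsBoldDelta α s`: the set `s` belongs to the ambiguous Borel class `Δ⁰_α`, i.e. both `s` and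
its complement belong to `Σ⁰_α`. -/
def IsBoldDelta {X : Type*} [TopologicalSpace X] (α : Ordinal.{0}) (s : Set X) : Prop :=
  IsBoldSigma α s ∧ IsBoldSigma α sᶜ

theorem IsOpen.exists_iUnion_isClopen {X : Type*} [TopologicalSpace X] [CompactSpace X] [T2Space X]
    [TotallyDisconnectedSpace X] [SecondCountableTopology X] {U : Set X} (hU : IsOpen U) :
    ∃ C : ℕ → Set X, (∀ n, IsClopen (C n)) ∧ U = ⋃ n, C n := by
  have hB : IsTopologicalBasis {s : Set X | IsClopen s} := isTopologicalBasis_isClopen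
  obtain ⟨S, hS, rfl⟩ := hB.open_eq_sUnion hU
  obtain ⟨T, hTc, hTS, hT⟩ := isOpen_sUnion_countable S fun s hs => (hS hs).isOpen
  -- adding `∅` makes the countable family nonempty, so that it can be enumerated by `ℕ`
  obtain ⟨C, hC⟩ := (hTc.insert ∅).exists_eq_range (insert_nonempty _ _)
  refine ⟨C, fun n => ?_, ?_⟩
  · have : C n ∈ insert ∅ T := hC ▸ mem_range_self n
    rcases this with h | h
    · rw [h]; exact isClopen_empty
    · exact hS (hTS h)
  · rw [← hT, ← sUnion_range, ← hC, sUnion_insert, empty_union]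

theorem IsBoldSigma.one_le {X : Type*} [TopologicalSpace X] {α : Ordinal.{0}} {s : Set X}
    (h : IsBoldSigma α s) : 1 ≤ α := by
  cases h with
  | of_isOpen _ => exact le_rfl
  | iUnion hα => exact hα.le

theorem IsBoldSigma.isOpen_of_one {X : Type*} [TopologicalSpace X] {s : Set X}
    (h : IsBoldSigma 1 s) : IsOpen s := by
  generalize hα : (1 : Ordinal.{0}) = α at h
  cases h with
  | of_isOpen hs => exact hs
  | iUnion h1 => exact absurd hα h1.ne

/-- Inversion of `IsBoldSigma.iUnion`. -/
theorem IsBoldSigma.exists_iUnion_of_one_lt {X : Type*} [TopologicalSpace X] {α : Ordinal.{0}}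
    {s : Set X} (h : IsBoldSigma α s) (hα : 1 < α) :
    ∃ (γ : ℕ → Ordinal.{0}) (C : ℕ → Set X), (∀ k, 1 ≤ γ k) ∧ (∀ k, γ k < α) ∧
      (∀ k, IsBoldSigma (γ k) (C k)ᶜ) ∧ s = ⋃ k, C k := by
  cases h with
  | of_isOpen => exact absurd hα (lt_irrefl _)
  | iUnion _ γ C h1 hlt hC => exact ⟨γ, C, h1, hlt, hC, rfl⟩

theorem IsBoldSigma.preimage {X Y : Type*} [TopologicalSpace X] [TopologicalSpace Y]
    {α : Ordinal.{0}} {s : Set X} (h : IsBoldSigma α s) {f : Y → X} (hf : Continuous f) :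
    IsBoldSigma α (f ⁻¹' s) := by
  induction h with
  | of_isOpen hs => exact .of_isOpen (hs.preimage hf)
  | iUnion hα β A h1 hlt _ ih =>
    rw [preimage_iUnion]
    exact .iUnion hα β _ h1 hlt ih

/-- A `Π⁰_α` set is `Σ⁰_β` for every `β > α`. -/
theorem IsBoldSigma.of_compl_of_lt {X : Type*} [TopologicalSpace X] {α β : Ordinal.{0}}
    {s : Set X} (h : IsBoldSigma α sᶜ) (hlt : α < β) : IsBoldSigma β s := by
  rw [← iUnion_const (ι := ℕ) s]
  exact .iUnion (h.one_le.trans_lt hlt) (fun _ => α) _ (fun _ => h.one_le) (fun _ => hlt)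
    fun _ => h

theorem IsBoldSigma.compl_of_lt {X : Type*} [TopologicalSpace X] {α β : Ordinal.{0}}
    {s : Set X} (h : IsBoldSigma α s) (hlt : α < β) : IsBoldSigma β sᶜ :=
  .of_compl_of_lt (by rwa [compl_compl]) hlt

theorem IsClopen.isBoldSigma {X : Type*} [TopologicalSpace X] {α : Ordinal.{0}} {s : Set X}
    (h : IsClopen s) (hα : 1 ≤ α) : IsBoldSigma α s := by
  rcases hα.eq_or_lt with rfl | hα
  · exact .of_isOpen h.isOpen
  · exact .of_compl_of_lt (.of_isOpen h.compl.isOpen) hα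

theorem IsClopen.isBoldDelta {X : Type*} [TopologicalSpace X] {α : Ordinal.{0}} {s : Set X}
    (h : IsClopen s) (hα : 1 ≤ α) : IsBoldDelta α s :=
  ⟨h.isBoldSigma hα, h.compl.isBoldSigma hα⟩

theorem IsBoldDelta.compl {X : Type*} [TopologicalSpace X] {α : Ordinal.{0}} {s : Set X}
    (h : IsBoldDelta α s) : IsBoldDelta α sᶜ :=
  ⟨h.2, by rw [compl_compl]; exact h.1⟩

theorem IsBoldSigma.iUnion_nat {X : Type*} [TopologicalSpace X] {α : Ordinal.{0}}
    (hα : 1 ≤ α) {A : ℕ → Set X} (h : ∀ n, IsBoldSigma α (A n)) :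
    IsBoldSigma α (⋃ n, A n) := by
  rcases hα.eq_or_lt with rfl | hα
  · refine .of_isOpen (isOpen_iUnion fun n => ?_)
    exact (h n).isOpen_of_one
  · choose γ C h1 hlt hC hA using fun n => (h n).exists_iUnion_of_one_lt hα
    have : ⋃ n, A n = ⋃ p : ℕ, C p.unpair.1 p.unpair.2 := by
      rw [iUnion_unpair (fun i j => C i j)]
      exact iUnion_congr hA
    rw [this]
    exact .iUnion hα (fun p => γ p.unpair.1 p.unpair.2) _ (fun p => h1 _ _) (fun p => hlt _ _)
      fun p => hC _ _

theorem IsBoldSigma.union {X : Type*} [TopologicalSpace X] {α : Ordinal.{0}} {s t : Set X}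
    (hs : IsBoldSigma α s) (ht : IsBoldSigma α t) : IsBoldSigma α (s ∪ t) := by
  have : s ∪ t = ⋃ n : ℕ, if n = 0 then s else t := by
    ext x
    simp only [mem_union, mem_iUnion]
    refine ⟨fun h => h.elim (fun h => ⟨0, h⟩) fun h => ⟨1, h⟩, ?_⟩
    rintro ⟨n, hn⟩
    split_ifs at hn
    exacts [.inl hn, .inr hn]
  rw [this]
  refine .iUnion_nat hs.one_le fun n => ?_
  split_ifs
  exacts [hs, ht]

variable {X : Type*} [TopologicalSpace X] [CompactSpace X] [T2Space X] [TotallyDisconnectedSpace X]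
  [SecondCountableTopology X] {α β : Ordinal.{0}} {s t : Set X}

theorem IsBoldSigma.mono (h : IsBoldSigma α s) (hle : α ≤ β) : IsBoldSigma β s := by
  cases h with
  | of_isOpen hs =>
    rcases hle.eq_or_lt with rfl | hlt
    · exact .of_isOpen hs
    · obtain ⟨C, hC, rfl⟩ := hs.exists_iUnion_isClopen
      exact .iUnion hlt (fun _ => 1) C (fun _ => le_rfl) (fun _ => hlt)
        fun n => .of_isOpen (hC n).compl.isOpen
  | iUnion hα γ A h1 hlt hA =>
    exact .iUnion (hα.trans_le hle) γ A h1 (fun n => (hlt n).trans_le hle) hA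

theorem IsBoldDelta.mono (h : IsBoldDelta α s) (hle : α ≤ β) : IsBoldDelta β s :=
  ⟨h.1.mono hle, h.2.mono hle⟩

/-- A `Σ⁰_α` set is the union of a sequence of sets each of which is ambiguous at a successor level
`ξ n + 1 ≤ α`. For `α = 1` these are clopen sets. -/
theorem IsBoldSigma.exists_iUnion_isBoldDelta (h : IsBoldSigma α s) :
    ∃ (ξ : ℕ → Ordinal.{0}) (C : ℕ → Set X),
      (∀ n, ξ n < α) ∧ (∀ n, IsBoldDelta (ξ n + 1) (C n)) ∧ s = ⋃ n, C n := by
  cases h with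
  | of_isOpen hs =>
    obtain ⟨C, hC, rfl⟩ := hs.exists_iUnion_isClopen
    exact ⟨fun _ => 0, C, fun _ => zero_lt_one, fun n => (hC n).isBoldDelta (by simp), rfl⟩
  | iUnion hα γ A h1 hlt hA =>
    exact ⟨γ, A, hlt, fun n => ⟨(hA n).of_compl_of_lt (lt_add_one _),
      (hA n).mono (lt_add_one _).le⟩, rfl⟩

theorem IsBoldSigma.inter (hs : IsBoldSigma α s) (ht : IsBoldSigma α t) :
    IsBoldSigma α (s ∩ t) := by
  have hα := hs.one_le
  rcases hα.eq_or_lt with rfl | h1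
  · exact .of_isOpen (hs.isOpen_of_one.inter ht.isOpen_of_one)
  · obtain ⟨ξ, A, -, hξ, hA, rfl⟩ := hs.exists_iUnion_of_one_lt h1
    obtain ⟨η, B, -, hη, hB, rfl⟩ := ht.exists_iUnion_of_one_lt h1
    rw [iUnion_inter]
    refine .iUnion_nat hα fun n => ?_
    rw [inter_iUnion]
    refine .iUnion_nat hα fun m => .of_compl_of_lt ?_ (max_lt (hξ n) (hη m))
    rw [compl_inter]
    exact ((hA n).mono (le_max_left _ _)).union ((hB m).mono (le_max_right _ _))

theorem IsBoldDelta.inter (hs : IsBoldDelta α s) (ht : IsBoldDelta α t) :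
    IsBoldDelta α (s ∩ t) :=
  ⟨hs.1.inter ht.1, by rw [compl_inter]; exact hs.2.union ht.2⟩

theorem IsBoldDelta.biInter_lt (hα : 1 ≤ α) {A : ℕ → Set X} (N : ℕ)
    (h : ∀ n < N, IsBoldDelta α (A n)) : IsBoldDelta α (⋂ n < N, A n) := by
  induction N with
  | zero => simpa using isClopen_univ.isBoldDelta hα
  | succ N ih =>
    rw [biInter_lt_succ]
    exact (ih fun n hn => h n (hn.trans N.lt_succ_self)).inter (h N N.lt_succ_self)

theorem IsBoldDelta.biUnion_lt (hα : 1 ≤ α) {A : ℕ → Set X} (N : ℕ)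
    (h : ∀ n < N, IsBoldDelta α (A n)) : IsBoldDelta α (⋃ n < N, A n) := by
  have := (biInter_lt hα N fun n hn => (h n hn).compl).compl
  simpa only [compl_iInter, compl_compl] using this

/-- The reduction property of the additive Borel classes. -/
theorem IsBoldSigma.reduction (hs : IsBoldSigma α s) (ht : IsBoldSigma α t) :
    ∃ s' t' : Set X, IsBoldSigma α s' ∧ IsBoldSigma α t' ∧ Disjoint s' t' ∧ s' ⊆ s ∧ t' ⊆ t ∧
      s' ∪ t' = s ∪ t := by
  have hα := hs.one_le
  obtain ⟨ξ, A, hξ, hA, rfl⟩ := hs.exists_iUnion_isBoldDelta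
  obtain ⟨η, B, hη, hB, rfl⟩ := ht.exists_iUnion_isBoldDelta
  replace hA n : IsBoldDelta α (A n) := (hA n).mono (Order.add_one_le_of_lt (hξ n))
  replace hB n : IsBoldDelta α (B n) := (hB n).mono (Order.add_one_le_of_lt (hη n))
  -- a point goes to the side that captures it first, ties going to the left
  refine ⟨⋃ n, A n ∩ ⋂ m < n, (B m)ᶜ, ⋃ n, B n ∩ ⋂ m < n + 1, (A m)ᶜ,
    .iUnion_nat hα fun n => ((hA n).inter (.biInter_lt hα _ fun m _ => (hB m).compl)).1,
    .iUnion_nat hα fun n => ((hB n).inter (.biInter_lt hα _ fun m _ => (hA m).compl)).1,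
    ?_, iUnion_mono fun _ => inter_subset_left, iUnion_mono fun _ => inter_subset_left, ?_⟩
  · simp only [Set.disjoint_left, mem_iUnion, mem_inter_iff, mem_iInter, mem_compl_iff]
    rintro x ⟨n, hn, hn'⟩ ⟨m, hm, hm'⟩
    rcases lt_or_ge m n with h | h
    · exact hn' m h hm
    · exact hm' n (Nat.lt_succ_of_le h) hn
  · refine (union_subset_union (iUnion_mono fun _ => inter_subset_left)
      (iUnion_mono fun _ => inter_subset_left)).antisymm fun x hx => ?_
    classical
    have hex : ∃ n, x ∈ A n ∨ x ∈ B n := by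
      rcases hx with hx | hx <;> obtain ⟨n, hn⟩ := mem_iUnion.1 hx
      exacts [⟨n, .inl hn⟩, ⟨n, .inr hn⟩]
    have hmin : ∀ m < Nat.find hex, x ∉ A m ∧ x ∉ B m :=
      fun m hm => not_or.1 (Nat.find_min hex hm)
    simp only [mem_union, mem_iUnion, mem_inter_iff, mem_iInter, mem_compl_iff]
    by_cases hxA : x ∈ A (Nat.find hex)
    · exact .inl ⟨_, hxA, fun m hm => (hmin m hm).2⟩
    · refine .inr ⟨_, (Nat.find_spec hex).resolve_left hxA, fun m hm => ?_⟩
      rcases (Nat.lt_succ_iff.1 hm).eq_or_lt with rfl | hm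
      exacts [hxA, (hmin m hm).1]

end Hierarchy

/-! ### Universal sets and non-separation in Cantor space -/

theorem Ordinal.countable_Iio_of_lt_omega_one {α : Ordinal.{0}} (h : α < ω_ 1) :
    (Set.Iio α).Countable := by
  rw [← Cardinal.ord_aleph, Cardinal.lt_ord, ← Cardinal.succ_aleph0, Order.lt_succ_iff] at h
  rw [← Cardinal.le_aleph0_iff_set_countable, Cardinal.mk_Iio_ordinal]
  exact Cardinal.lift_le_aleph0.2 h

/-- Universal `Σ⁰_α` sets, given by their sections `U a`. The second property expresses that
`{(a, x) | x ∈ U a}` is `Σ⁰_α` by means of its preimages under the maps `x ↦ (f x, x)`. -/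
theorem exists_universal_isBoldSigma (α : Ordinal.{0}) (h1 : 1 ≤ α) (hα : α < ω_ 1) :
    ∃ U : (ℕ → Bool) → Set (ℕ → Bool), (∀ s, IsBoldSigma α s → ∃ a, U a = s) ∧
      ∀ f : (ℕ → Bool) → (ℕ → Bool), Continuous f → IsBoldSigma α {x | x ∈ U (f x)} := by
  induction α using WellFoundedLT.induction with
  | ind α ih =>
  rcases h1.eq_or_lt with rfl | h1
  · obtain ⟨b, hb⟩ := (countable_countableBasis (ℕ → Bool)).exists_eq_range <| by
      by_contra! hempty
      have := (isBasis_countableBasis (ℕ → Bool)).sUnion_eq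
      rw [hempty, sUnion_empty] at this
      exact empty_ne_univ this
    have hopen n : IsOpen (b n) := isOpen_of_mem_countableBasis (hb ▸ mem_range_self n)
    refine ⟨fun a => {x | ∃ n, a n = true ∧ x ∈ b n}, fun s hs => ?_, fun f hf => ?_⟩
    · replace hs : IsOpen s := hs.isOpen_of_one
      classical
      refine ⟨fun n => decide (b n ⊆ s), ?_⟩
      ext x
      simp only [decide_eq_true_eq, mem_ofPred_eq]
      refine ⟨fun ⟨n, hn, hx⟩ => hn hx, fun hx => ?_⟩
      obtain ⟨v, hv, hxv, hvs⟩ :=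
        (isBasis_countableBasis (ℕ → Bool)).exists_subset_of_mem_open hx hs
      obtain ⟨n, rfl⟩ : v ∈ range b := hb ▸ hv
      exact ⟨n, hvs, hxv⟩
    · have : {x | ∃ n, f x n = true ∧ x ∈ b n} = ⋃ n, {x | f x n = true} ∩ b n := by
        ext x; simp
      change IsBoldSigma 1 {x | ∃ n, f x n = true ∧ x ∈ b n}
      rw [this]
      refine .of_isOpen <| isOpen_iUnion fun n => IsOpen.inter ?_ (hopen n)
      exact (isOpen_discrete {true}).preimage ((continuous_apply n).comp hf)
  · obtain ⟨e, he⟩ := ((countable_Iio_of_lt_omega_one hα).mono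
      (Set.Ico_subset_Iio_self (a := (1 : Ordinal.{0})))).exists_eq_range ⟨1, le_rfl, h1⟩
    have hmem n : e n ∈ Set.Ico 1 α := he ▸ mem_range_self n
    choose U hU hU' using fun n => ih (e n) (hmem n).2 (hmem n).1 ((hmem n).2.trans hα)
    -- the code `a` is split into infinitely many codes, the `k`-th one being `n ↦ a (pair k n)`
    -- every level `e i` is used for infinitely many `k`, to leave room for repetitions
    refine ⟨fun a => ⋃ k : ℕ, (U k.unpair.2 fun n => a (Nat.pair k n))ᶜ, fun s hs => ?_,
      fun f hf => ?_⟩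
    · obtain ⟨β, A, hβ1, hβ, hA, rfl⟩ := hs.exists_iUnion_of_one_lt h1
      have hex : ∀ k : ℕ, ∃ a, (e k.unpair.2 = β k.unpair.1 → U k.unpair.2 a = (A k.unpair.1)ᶜ) ∧
          (e k.unpair.2 ≠ β k.unpair.1 → U k.unpair.2 a = Set.univ) := by
        intro k
        by_cases hk : e k.unpair.2 = β k.unpair.1
        · obtain ⟨a, ha⟩ := hU k.unpair.2 (A k.unpair.1)ᶜ (hk ▸ hA _)
          exact ⟨a, fun _ => ha, fun h => absurd hk h⟩
        · obtain ⟨a, ha⟩ := hU k.unpair.2 Set.univ (isClopen_univ.isBoldSigma (hmem _).1)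
          exact ⟨a, fun h => absurd h hk, fun _ => ha⟩
      choose a ha ha' using hex
      refine ⟨fun n => a n.unpair.1 n.unpair.2, ?_⟩
      simp only [Nat.unpair_pair]
      ext x
      simp only [mem_iUnion, mem_compl_iff]
      constructor
      · rintro ⟨k, hk⟩
        by_cases hke : e k.unpair.2 = β k.unpair.1
        · rw [ha k hke, mem_compl_iff, not_not] at hk
          exact ⟨_, hk⟩
        · rw [ha' k hke] at hk
          exact absurd (mem_univ x) hk
      · rintro ⟨n, hn⟩
        obtain ⟨i, hi⟩ : β n ∈ range e := he ▸ ⟨hβ1 n, hβ n⟩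
        refine ⟨Nat.pair n i, ?_⟩
        rw [ha _ (by simpa using hi)]
        simpa using hn
    · have : {x | x ∈ ⋃ k : ℕ, (U k.unpair.2 fun n => f x (Nat.pair k n))ᶜ} =
          ⋃ k : ℕ, {x | x ∈ U k.unpair.2 fun n => f x (Nat.pair k n)}ᶜ := by
        ext x; simp
      rw [this]
      refine .iUnion h1 (fun k => e k.unpair.2) _ (fun k => (hmem _).1) (fun k => (hmem _).2)
        fun k => ?_
      rw [compl_compl]
      exact hU' _ (fun x n => f x (Nat.pair k n))
        (continuous_pi fun n => (continuous_apply _).comp hf)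

/-- The multiplicative classes separate less than the additive ones: in Cantor space there are
disjoint `Σ⁰_α` sets that no disjoint `Π⁰_α` sets separate. -/
theorem exists_disjoint_not_separated (α : Ordinal.{0}) (h1 : 1 ≤ α) (hα : α < ω_ 1) :
    ∃ A B : Set (ℕ → Bool), IsBoldSigma α A ∧ IsBoldSigma α B ∧ Disjoint A B ∧
      ¬ ∃ P Q : Set (ℕ → Bool), IsBoldPi α P ∧ IsBoldPi α Q ∧ Disjoint P Q ∧ A ⊆ P ∧ B ⊆ Q := by
  obtain ⟨U, hU, hU'⟩ := exists_universal_isBoldSigma α h1 hα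
  -- a point `x` codes the pair of sets `U (n ↦ x (2 * n))`, `U (n ↦ x (2 * n + 1))`
  have h0 := hU' (fun x n => x (2 * n)) (by fun_prop)
  have h1 := hU' (fun x n => x (2 * n + 1)) (by fun_prop)
  obtain ⟨A, B, hA, hB, hAB, hA0, hB1, hun⟩ := h0.reduction h1
  refine ⟨A, B, hA, hB, hAB, ?_⟩
  rintro ⟨P, Q, hP, hQ, hPQ, hAP, hBQ⟩
  obtain ⟨a, ha⟩ := hU _ hP
  obtain ⟨b, hb⟩ := hU _ hQ
  -- the point that codes the pair `(Pᶜ, Qᶜ)`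
  let x : ℕ → Bool := fun n => if n % 2 = 0 then a (n / 2) else b (n / 2)
  have hxa : (fun n => x (2 * n)) = a := by
    funext n
    simp [x]
  have hxb : (fun n => x (2 * n + 1)) = b := by
    funext n
    have h2 : (2 * n + 1) / 2 = n := by omega
    simp [x, h2, Nat.add_mod]
  have hxA : x ∈ A → x ∉ P := fun h => by
    have := hA0 h
    rwa [mem_ofPred_eq, hxa, ha] at this
  have hxB : x ∈ B → x ∉ Q := fun h => by
    have := hB1 h
    rwa [mem_ofPred_eq, hxb, hb] at this
  have hx : x ∈ A ∪ B := by
    rw [hun, mem_union, mem_ofPred_eq, mem_ofPred_eq, hxa, hxb, ha, hb]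
    by_contra! h
    exact Set.disjoint_left.1 hPQ (not_not.1 h.1) (not_not.1 h.2)
  rcases hx with hx | hx
  · exact hxA hx (hAP hx)
  · exact hxB hx (hBQ hx)

/-! ### The spaces attached to trees and the fundamental system -/

namespace OmegaTree

instance instCompactSpaceSpace (t : OmegaTree) : CompactSpace t.Space := by
  induction t with
  | leaf => exact inferInstanceAs (CompactSpace Bool)
  | node t ih => exact inferInstanceAs (CompactSpace (∀ n, (t n).Space))

instance instT2SpaceSpace (t : OmegaTree) : T2Space t.Space := by
  induction t with
  | leaf => exact inferInstanceAs (T2Space Bool)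
  | node t ih => exact inferInstanceAs (T2Space (∀ n, (t n).Space))

instance instTotallyDisconnectedSpaceSpace (t : OmegaTree) : TotallyDisconnectedSpace t.Space := by
  induction t with
  | leaf => exact inferInstanceAs (TotallyDisconnectedSpace Bool)
  | node t ih => exact inferInstanceAs (TotallyDisconnectedSpace (∀ n, (t n).Space))

instance instSecondCountableTopologySpace (t : OmegaTree) :
    SecondCountableTopology t.Space := by
  induction t with
  | leaf => exact inferInstanceAs (SecondCountableTopology Bool)
  | node t ih => exact inferInstanceAs (SecondCountableTopology (∀ n, (t n).Space))

theorem mem_eventualSet_node {b : Bool} {t : ℕ → OmegaTree} {x : (node t).Space} :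
    x ∈ (node t).eventualSet b ↔ ∀ᶠ m in atTop, (x : ∀ n, (t n).Space) m ∈ (t m).eventualSet b := by
  rw [eventually_atTop]
  constructor
  · rintro ⟨n, hn⟩
    exact ⟨n + 1, fun m hm => hn m hm⟩
  · rintro ⟨n, hn⟩
    exact ⟨n, fun m hm => hn m (le_of_lt hm)⟩

end OmegaTree

theorem FundamentalSystem.eventually_le_seq (π : FundamentalSystem) {α ξ : Ordinal.{0}}
    (hα : α < ω_ 1) (hξ : ξ < α) : ∀ᶠ m in atTop, ξ ≤ π.seq α m := by
  rcases zero_or_succ_or_isSuccLimit α with rfl | ⟨β, rfl⟩ | h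
  · exact absurd hξ not_lt_zero
  · rw [Order.succ_eq_add_one] at *
    refine .of_forall fun m => ?_
    rw [π.seq_succ β hα m]
    exact Order.lt_add_one_iff.1 hξ
  · obtain ⟨n, hn⟩ := π.seq_cofinal α h hα ξ hξ
    filter_upwards [eventually_ge_atTop n] with m hm
    exact hn.trans (π.seq_mono α h hα hm)

/-! ### Separation by additive sets -/

/-- If the `m`-th coordinate sets are separated by disjoint `Σ⁰_{ξ m + 1}` sets with `ξ m < α`, then
the eventual sets of the node are separated by disjoint `Σ⁰_{α+1}` sets. -/
theorem OmegaTree.exists_separation_node {t : ℕ → OmegaTree} {α : Ordinal.{0}} (hα : 1 ≤ α)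
    {ξ : ℕ → Ordinal.{0}} (hξ : ∀ m, ξ m < α)
    (h : ∀ m, ∃ A B : Set (t m).Space, IsBoldSigma (ξ m + 1) A ∧ IsBoldSigma (ξ m + 1) B ∧
      Disjoint A B ∧ (t m).eventualSet true ⊆ A ∧ (t m).eventualSet false ⊆ B) :
    ∃ A B : Set (node t).Space, IsBoldSigma (α + 1) A ∧ IsBoldSigma (α + 1) B ∧
      Disjoint A B ∧ (node t).eventualSet true ⊆ A ∧ (node t).eventualSet false ⊆ B := by
  choose A B hA hB hAB hFA hIB using h
  let E (C : ∀ m, Set (t m).Space) : Set (node t).Space :=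
    ⋃ n : ℕ, (⋃ m : ℕ, {x : ∀ n, (t n).Space | n ≤ m ∧ x m ∈ C m})ᶜ
  have hmem (C : ∀ m, Set (t m).Space) (x : ∀ n, (t n).Space) :
      (x ∈ E C) ↔ ∀ᶠ m in atTop, x m ∉ C m := by
    rw [eventually_atTop]
    refine mem_iUnion.trans (exists_congr fun n => ?_)
    exact ⟨fun h m hm hC => h (mem_iUnion.2 ⟨m, hm, hC⟩), fun h hx =>
      have ⟨m, hm, hC⟩ := mem_iUnion.1 hx
      h m hm hC⟩
  have hE (C : ∀ m, Set (t m).Space) (hC : ∀ m, IsBoldSigma (ξ m + 1) (C m)) :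
      IsBoldSigma (α + 1) (E C) := by
    refine .iUnion_nat (by simp) fun n => .compl_of_lt (.iUnion_nat hα fun m => ?_) (lt_add_one α)
    by_cases hnm : n ≤ m
    · simp only [hnm, true_and]
      exact ((hC m).mono (Order.add_one_le_of_lt (hξ m))).preimage
        (f := fun x : ∀ n, (t n).Space => x m) (continuous_apply m)
    · simp only [hnm, false_and]
      exact isClopen_empty.isBoldSigma hα
  obtain ⟨P, Q, hP, hQ, hPQ, hPB, hQA, hun⟩ := (hE B hB).reduction (hE A hA)
  refine ⟨P, Q, hP, hQ, hPQ, fun x hx => ?_, fun x hx => ?_⟩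
  · rw [mem_eventualSet_node] at hx
    have h1 : x ∈ E B := (hmem B x).2 <| hx.mono fun m hm =>
      Set.disjoint_left.1 (hAB m) (hFA m hm)
    have h2 : x ∉ E A := fun h2 => by
      obtain ⟨m, hm, hm'⟩ := (hx.and ((hmem A x).1 h2)).exists
      exact hm' (hFA m hm)
    exact (hun.ge (.inl h1) : x ∈ P ∪ Q).resolve_right fun h => h2 (hQA h)
  · rw [mem_eventualSet_node] at hx
    have h1 : x ∈ E A := (hmem A x).2 <| hx.mono fun m hm =>
      Set.disjoint_right.1 (hAB m) (hIB m hm)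
    have h2 : x ∉ E B := fun h2 => by
      obtain ⟨m, hm, hm'⟩ := (hx.and ((hmem B x).1 h2)).exists
      exact hm' (hIB m hm)
    exact (hun.ge (.inr h1) : x ∈ P ∪ Q).resolve_left fun h => h2 (hPB h)

theorem FundamentalSystem.exists_isBoldSigma_separation (π : FundamentalSystem) (α : Ordinal.{0})
    (hα : α < ω_ 1) :
    ∃ A B : Set (π.Space α), IsBoldSigma (α + 1) A ∧ IsBoldSigma (α + 1) B ∧
      Disjoint A B ∧ (π.tree α).eventualSet true ⊆ A ∧ (π.tree α).eventualSet false ⊆ B := by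
  induction α using WellFoundedLT.induction with
  | ind α ih =>
  rcases eq_zero_or_pos α with rfl | h0
  · unfold FundamentalSystem.Space
    rw [π.tree_zero, zero_add]
    refine ⟨({true} : Set Bool), ({false} : Set Bool),
      .of_isOpen (isOpen_discrete ({true} : Set Bool)),
      .of_isOpen (isOpen_discrete ({false} : Set Bool)), ?_, subset_rfl, subset_rfl⟩
    exact disjoint_singleton.2 (by decide : true ≠ false)
  · unfold FundamentalSystem.Space
    rw [π.tree_of_pos h0 hα]
    exact OmegaTree.exists_separation_node (Order.one_le_iff_pos.2 h0)
      (fun m => π.seq_lt_self h0 hα m)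
      fun m => ih _ (π.seq_lt_self h0 hα m) ((π.seq_lt_self h0 hα m).trans hα)

/-! ### Disjoint additive sets are mapped continuously into the iterated filter and ideal -/

section Completeness

variable {Y : Type*} [TopologicalSpace Y] [CompactSpace Y] [T2Space Y] [TotallyDisconnectedSpace Y]
  [SecondCountableTopology Y]

/-- A sequence of `Π⁰_α` sets has ambiguous approximations from above, uniformly: for each `m` the
approximations of stage `m` have rank `ξ m + 1`, where `ξ` is eventually above every ordinal
below `α`. -/
theorem exists_isBoldDelta_approximation {α : Ordinal.{0}} {ξ : ℕ → Ordinal.{0}}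
    (hξ : ∀ η < α, ∀ᶠ m in atTop, η ≤ ξ m) {A : ℕ → Set Y} (hA : ∀ k, IsBoldSigma α (A k)ᶜ) :
    ∃ E : ℕ → ℕ → Set Y, (∀ k m, IsBoldDelta (ξ m + 1) (E k m)) ∧ (∀ k m, A k ⊆ E k m) ∧
      ∀ k, ∀ x ∉ A k, ∀ᶠ m in atTop, x ∉ E k m := by
  choose η C hη hC hAC using fun k => (hA k).exists_iUnion_isBoldDelta
  have hmem k x : x ∉ A k ↔ ∃ j, x ∈ C k j := by
    rw [← mem_compl_iff, hAC k, mem_iUnion]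
  refine ⟨fun k m => ⋂ j < m, {x | η k j ≤ ξ m → x ∉ C k j}, fun k m => ?_, fun k m x hx => ?_,
    fun k x hx => ?_⟩
  · refine .biInter_lt (by simp) _ fun j _ => ?_
    by_cases h : η k j ≤ ξ m
    · simp only [h, true_imp_iff]
      exact ((hC k j).mono (by gcongr)).compl
    · simp only [h, false_imp_iff]
      exact isClopen_univ.isBoldDelta (by simp)
  · simp only [mem_iInter, mem_ofPred_eq]
    exact fun j _ _ hj => (hmem k x).2 ⟨j, hj⟩ hx
  · obtain ⟨j, hj⟩ := (hmem k x).1 hx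
    filter_upwards [hξ _ (hη k j), eventually_gt_atTop j] with m hm hjm h
    simp only [mem_iInter, mem_ofPred_eq] at h
    exact h j hjm hm hj

/-- Two disjoint `Σ⁰_{α+1}` sets are told apart by the limit of a sequence of sets of lower ambiguous
ranks. -/
theorem exists_isBoldDelta_limit {α : Ordinal.{0}} (hα : 1 ≤ α) {ξ : ℕ → Ordinal.{0}}
    (hξ : ∀ η < α, ∀ᶠ m in atTop, η ≤ ξ m) {s t : Set Y} (hs : IsBoldSigma (α + 1) s)
    (ht : IsBoldSigma (α + 1) t) (hst : Disjoint s t) :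
    ∃ D : ℕ → Set Y, (∀ m, IsBoldDelta (ξ m + 1) (D m)) ∧
      (∀ x ∈ s, ∀ᶠ m in atTop, x ∈ D m) ∧ ∀ x ∈ t, ∀ᶠ m in atTop, x ∉ D m := by
  have key {u : Set Y} (hu : IsBoldSigma (α + 1) u) :
      ∃ A : ℕ → Set Y, (∀ k, IsBoldSigma α (A k)ᶜ) ∧ u = ⋃ k, A k := by
    have h2 : (1 : Ordinal.{0}) < α + 1 := Order.lt_add_one_iff.2 hα
    obtain ⟨γ, A, -, hlt, hA, rfl⟩ := hu.exists_iUnion_of_one_lt h2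
    exact ⟨A, fun k => (hA k).mono (Order.lt_add_one_iff.1 (hlt k)), rfl⟩
  obtain ⟨A, hA, rfl⟩ := key hs
  obtain ⟨B, hB, rfl⟩ := key ht
  obtain ⟨E, hE, hAE, hE'⟩ := exists_isBoldDelta_approximation hξ hA
  obtain ⟨G, hG, hBG, hG'⟩ := exists_isBoldDelta_approximation hξ hB
  -- at stage `m`, compare the least indices whose approximations `E k m` and `G k m` hold, ties
  -- going to `E`: for a point of `A k` the false candidates `i < k` have all disappeared eventually
  refine ⟨fun m => ⋃ k < m, E k m ∩ ⋂ i < k, (G i m)ᶜ, fun m => ?_, fun x hx => ?_,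
    fun x hx => ?_⟩
  · exact .biUnion_lt (by simp) _ fun k _ =>
      (hE k m).inter (.biInter_lt (by simp) _ fun i _ => (hG i m).compl)
  · have hxB i : x ∉ B i := fun h => Set.disjoint_left.1 hst hx (mem_iUnion.2 ⟨i, h⟩)
    obtain ⟨k, hk⟩ := mem_iUnion.1 hx
    have : ∀ᶠ m in atTop, ∀ i ∈ Set.Iio k, x ∉ G i m :=
      (eventually_all_finite (Set.finite_Iio k)).2 fun i _ => hG' i x (hxB i)
    filter_upwards [this, eventually_gt_atTop k] with m hm hkm
    simp only [mem_iUnion, mem_inter_iff, mem_iInter, mem_compl_iff]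
    exact ⟨k, hkm, hAE k m hk, hm⟩
  · have hxA i : x ∉ A i := fun h => Set.disjoint_right.1 hst hx (mem_iUnion.2 ⟨i, h⟩)
    obtain ⟨k, hk⟩ := mem_iUnion.1 hx
    have : ∀ᶠ m in atTop, ∀ i ∈ Set.Iic k, x ∉ E i m :=
      (eventually_all_finite (Set.finite_Iic k)).2 fun i _ => hE' i x (hxA i)
    filter_upwards [this] with m hm
    simp only [mem_iUnion, mem_inter_iff, mem_iInter, mem_compl_iff, not_exists]
    rintro i _ ⟨hi, hi'⟩
    rcases le_or_gt i k with h | h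
    · exact hm i h hi
    · exact hi' k h (hBG k m hk)

/-- Passage from the trees `T_β`, `β < α`, to `T_α`: if ambiguous sets of rank `β + 1` and their
complements are mapped continuously into `F^β` and `I^β` for all `β < α`, then disjoint `Σ⁰_{α+1}`
sets are mapped continuously into `F^α` and `I^α`. -/
theorem FundamentalSystem.exists_continuous_step (π : FundamentalSystem) {α : Ordinal.{0}}
    (h0 : 0 < α) (hα : α < ω_ 1)
    (ih : ∀ β < α, ∀ D : Set Y, IsBoldDelta (β + 1) D → ∃ f : Y → π.Space β, Continuous f ∧
      MapsTo f D ((π.tree β).eventualSet true) ∧ MapsTo f Dᶜ ((π.tree β).eventualSet false))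
    {s t : Set Y} (hs : IsBoldSigma (α + 1) s) (ht : IsBoldSigma (α + 1) t) (hst : Disjoint s t) :
    ∃ f : Y → π.Space α, Continuous f ∧
      MapsTo f s ((π.tree α).eventualSet true) ∧ MapsTo f t ((π.tree α).eventualSet false) := by
  obtain ⟨D, hD, hsD, htD⟩ := exists_isBoldDelta_limit (Order.one_le_iff_pos.2 h0)
    (fun η hη => π.eventually_le_seq hα hη) hs ht hst
  choose f hf hfD hfD' using fun m => ih (π.seq α m) (π.seq_lt_self h0 hα m) (D m) (hD m)
  unfold FundamentalSystem.Space
  rw [π.tree_of_pos h0 hα]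
  refine ⟨fun x m => f m x, continuous_pi hf, fun x hx => ?_, fun x hx => ?_⟩
  · exact OmegaTree.mem_eventualSet_node.2 ((hsD x hx).mono fun m hm => hfD m hm)
  · exact OmegaTree.mem_eventualSet_node.2 ((htD x hx).mono fun m hm => hfD' m hm)

theorem FundamentalSystem.exists_continuous_of_isBoldDelta (π : FundamentalSystem)
    (α : Ordinal.{0}) (hα : α < ω_ 1) (D : Set Y) (hD : IsBoldDelta (α + 1) D) :
    ∃ f : Y → π.Space α, Continuous f ∧
      MapsTo f D ((π.tree α).eventualSet true) ∧ MapsTo f Dᶜ ((π.tree α).eventualSet false) := by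
  induction α using WellFoundedLT.induction generalizing D with
  | ind α ih =>
  rcases eq_zero_or_pos α with rfl | h0
  · rw [zero_add] at hD
    have hclopen : IsClopen D := ⟨⟨hD.2.isOpen_of_one⟩, hD.1.isOpen_of_one⟩
    unfold FundamentalSystem.Space
    rw [π.tree_zero]
    classical
    refine ⟨fun y => (decide (y ∈ D) : Bool), ?_, fun y hy => ?_, fun y hy => ?_⟩
    · refine (continuous_bool_rng true).2 ?_
      convert hclopen
      ext y
      exact decide_eq_true_iff
    · exact decide_eq_true hy
    · exact decide_eq_false hy
  · exact π.exists_continuous_step h0 hα (fun β hβ E hE => ih β hβ (hβ.trans hα) E hE)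
      hD.1 hD.2 disjoint_compl_right

/-- For `0 < α < ω₁`, the pair `(F^α, I^α)` is complete for pairs of disjoint `Σ⁰_{α+1}` sets. -/
theorem FundamentalSystem.exists_continuous_of_disjoint (π : FundamentalSystem) {α : Ordinal.{0}}
    (h0 : 0 < α) (hα : α < ω_ 1) {s t : Set Y} (hs : IsBoldSigma (α + 1) s)
    (ht : IsBoldSigma (α + 1) t) (hst : Disjoint s t) :
    ∃ f : Y → π.Space α, Continuous f ∧
      MapsTo f s ((π.tree α).eventualSet true) ∧ MapsTo f t ((π.tree α).eventualSet false) :=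
  π.exists_continuous_step h0 hα
    (fun β hβ => π.exists_continuous_of_isBoldDelta β (hβ.trans hα)) hs ht hst

end Completeness

theorem theorem1p2 (π : FundamentalSystem) (α : Ordinal.{0}) (hα : α < ω_ 1) :
    (1 ≤ α → ¬ ∃ A B : Set (π.Space α), IsBoldPi (α + 1) A ∧ IsBoldPi (α + 1) B ∧
      Disjoint A B ∧ π.frechetFilter α ⊆ A ∧ π.frechetIdeal α ⊆ B) ∧
    (∃ A B : Set (π.Space α), IsBoldSigma (α + 1) A ∧ IsBoldSigma (α + 1) B ∧
      Disjoint A B ∧ π.frechetFilter α ⊆ A ∧ π.frechetIdeal α ⊆ B) := by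
  refine ⟨?_, π.exists_isBoldSigma_separation α hα⟩
  rintro h1 ⟨P, Q, hP, hQ, hPQ, hFP, hIQ⟩
  have hα' : α + 1 < ω_ 1 := (Cardinal.isSuccLimit_omega 1).add_one_lt hα
  obtain ⟨A, B, hA, hB, hAB, hsep⟩ := exists_disjoint_not_separated (α + 1) (by simp) hα'
  obtain ⟨f, hf, hfA, hfB⟩ :=
    π.exists_continuous_of_disjoint (Order.one_le_iff_pos.1 h1) hα hA hB hAB
  exact hsep ⟨f ⁻¹' P, f ⁻¹' Q, hP.preimage hf, hQ.preimage hf, hPQ.preimage f,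
    fun x hx => hFP (hfA hx), fun x hx => hIQ (hfB hx)⟩
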